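/- For a graph $G$ and an integer $k$, a vertex $v$ of $G$ is called $k$-enabling if it belongs both to a clique of size $k$ and to an independent set of size $k$, and $k$-excluding otherwise. **Theorem.** There is an absolute constant $C > 0$ such that for every fixed $0 < \delta < 1$ there are a (deterministic) algorithm and constants $K_\delta$ and $B_\delta$, depending only on $\delta$, with the following properties for all integers $n \ge 1$ and $k$ with $n \le (4-\delta)k$ and every graph $G$ on $n$ vertices. 1. If $k > K_\delta$, then $G$ has a $k$-excluding vertex. 2. On input $(G, k)$ the algorithm halts after at most $B_\delta \cdot n^{C/\delta^2}$ steps (that is, it runs in time $n^{O(1/\delta^2)}$), and if $k \le K_\delta$ it halts after at most $B_\delta$ steps. 3. If $G$ has a $k$-excluding vertex, then the algorithm outputs such a vertex $v$, together with a requirement that $v$ fails to satisfy: either it reports, correctly, that $v$ is not in any $k$-clique, or it reports, correctly, that $v$ is not in any $k$-independent set. If $G$ has no $k$-excluding vertex, the algorithm reports this. Here an algorithm is a program for a random access machine whose registers and memory cells hold natural numbers, with literals, addition, truncated subtraction, indirect loads and stores, and comparisons as unit-cost operations. The input is given as $n$, $k$ and the adjacency matrix of $G$. -/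

import Mathlib

/-! ## Cliques, independent sets and excluding vertices -/

/-- `v` belongs to a clique of `G` with exactly `k` vertices. -/
def InClique {V : Type*} (G : SimpleGraph V) (k : ℕ) (v : V) : Prop :=
  ∃ S : Finset V, v ∈ S ∧ G.IsNClique k S

/-- `v` belongs to an independent set of `G` with exactly `k` vertices. -/
def InIndepSet {V : Type*} (G : SimpleGraph V) (k : ℕ) (v : V) : Prop :=
  ∃ S : Finset V, v ∈ S ∧ G.IsNIndepSet k S

/-- `v` is `k`-enabling: it lies both in a `k`-clique and in a `k`-independent set. -/
def IsEnabling {V : Type*} (G : SimpleGraph V) (k : ℕ) (v : V) : Prop :=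
  InClique G k v ∧ InIndepSet G k v

/-- `v` is `k`-excluding: it is not `k`-enabling. -/
def IsExcluding {V : Type*} (G : SimpleGraph V) (k : ℕ) (v : V) : Prop :=
  ¬ IsEnabling G k v

/-! ## Random access machines

Structured programs for a random access machine. The machine has registers and an
indirectly addressed memory, all holding natural numbers. The arithmetic instructions are
addition and (truncated) subtraction; there is no multiplication. Every executed instruction
and every executed test takes one time step. As one step increases the bit length of the
largest stored number by at most one (up to the finitely many literals of the program), this
time measure is polynomially related to that of Turing machines. -/

namespace RAM

/-- A memory configuration: the contents of the registers and of the memory cells. -/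
structure State where
  reg : ℕ → ℕ
  mem : ℕ → ℕ

/-- The state obtained by writing `x` into register `r`. -/
def State.setReg (s : State) (r x : ℕ) : State :=
  { s with reg := Function.update s.reg r x }

/-- The state obtained by writing `x` into memory cell `a`. -/
def State.setMem (s : State) (a x : ℕ) : State :=
  { s with mem := Function.update s.mem a x }

/-- Programs. The arguments `r a b : ℕ` are register numbers, and `c : ℕ` is a literal. -/
inductive Program where
  /-- do nothing -/
  | skip : Program
  /-- `r := c` -/
  | const (r c : ℕ) : Program
  /-- `r := a + b` -/
  | add (r a b : ℕ) : Program
  /-- `r := a - b`, truncated at zero -/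
  | sub (r a b : ℕ) : Program
  /-- `r := mem[a]` -/
  | load (r a : ℕ) : Program
  /-- `mem[a] := b` -/
  | store (a b : ℕ) : Program
  /-- `P; Q` -/
  | seq (P Q : Program) : Program
  /-- `if a < b then P else Q` -/
  | branch (a b : ℕ) (P Q : Program) : Program
  /-- `while a < b do P` -/
  | loop (a b : ℕ) (P : Program) : Program

/-- `Runs P s t s'`: started in state `s`, the program `P` halts in state `s'` after
exactly `t` time steps. -/
inductive Runs : Program → State → ℕ → State → Prop where
  | skip (s : State) : Runs .skip s 1 s
  | const (s : State) (r c : ℕ) : Runs (.const r c) s 1 (s.setReg r c)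
  | add (s : State) (r a b : ℕ) : Runs (.add r a b) s 1 (s.setReg r (s.reg a + s.reg b))
  | sub (s : State) (r a b : ℕ) : Runs (.sub r a b) s 1 (s.setReg r (s.reg a - s.reg b))
  | load (s : State) (r a : ℕ) : Runs (.load r a) s 1 (s.setReg r (s.mem (s.reg a)))
  | store (s : State) (a b : ℕ) : Runs (.store a b) s 1 (s.setMem (s.reg a) (s.reg b))
  | seq {P Q : Program} {s₁ s₂ s₃ : State} {t₁ t₂ : ℕ} :
      Runs P s₁ t₁ s₂ → Runs Q s₂ t₂ s₃ → Runs (.seq P Q) s₁ (t₁ + t₂) s₃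
  | branch_true {P Q : Program} {a b : ℕ} {s s' : State} {t : ℕ} :
      s.reg a < s.reg b → Runs P s t s' → Runs (.branch a b P Q) s (t + 1) s'
  | branch_false {P Q : Program} {a b : ℕ} {s s' : State} {t : ℕ} :
      ¬ s.reg a < s.reg b → Runs Q s t s' → Runs (.branch a b P Q) s (t + 1) s'
  | loop_done {P : Program} {a b : ℕ} {s : State} :
      ¬ s.reg a < s.reg b → Runs (.loop a b P) s 1 s
  | loop_step {P : Program} {a b : ℕ} {s₁ s₂ s₃ : State} {t₁ t₂ : ℕ} :
      s₁.reg a < s₁.reg b → Runs P s₁ t₁ s₂ → Runs (.loop a b P) s₂ t₂ s₃ →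
      Runs (.loop a b P) s₁ (t₁ + t₂ + 1) s₃

/-- Programs are deterministic: the running time and the final state are unique. -/
theorem Runs.unique {P : Program} {s s₁ s₂ : State} {t₁ t₂ : ℕ}
    (h₁ : Runs P s t₁ s₁) (h₂ : Runs P s t₂ s₂) : t₁ = t₂ ∧ s₁ = s₂ := by
  induction h₁ generalizing t₂ s₂ with
  | skip | const | add | sub | load | store => cases h₂; exact ⟨rfl, rfl⟩
  | seq _ _ ihP ihQ =>
    cases h₂ with
    | seq p q => obtain ⟨rfl, rfl⟩ := ihP p; obtain ⟨rfl, rfl⟩ := ihQ q; exact ⟨rfl, rfl⟩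
  | branch_true hc _ ih =>
    cases h₂ with
    | branch_true _ p => obtain ⟨rfl, rfl⟩ := ih p; exact ⟨rfl, rfl⟩
    | branch_false hn _ => exact absurd hc hn
  | branch_false hn _ ih =>
    cases h₂ with
    | branch_true hc _ => exact absurd hc hn
    | branch_false _ p => obtain ⟨rfl, rfl⟩ := ih p; exact ⟨rfl, rfl⟩
  | loop_done hn =>
    cases h₂ with
    | loop_done _ => exact ⟨rfl, rfl⟩
    | loop_step hc _ _ => exact absurd hc hn
  | loop_step hc _ _ ihP ihL =>
    cases h₂ with
    | loop_done hn => exact absurd hc hn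
    | loop_step _ p q =>
      obtain ⟨rfl, rfl⟩ := ihP p; obtain ⟨rfl, rfl⟩ := ihL q; exact ⟨rfl, rfl⟩

end RAM

/-! ## Input and output of the algorithm -/

open Classical in
/-- The initial state on input `(G, k)`, where `G` is a graph with vertex set
`{0, …, n - 1}`: register `0` holds `n`, register `1` holds `k`, all other registers hold `0`,
and the memory holds the adjacency matrix of `G`, the entry in row `i` and column `j` being
stored in cell `i * n + j`. All other cells hold `0`. -/
noncomputable def inputState {n : ℕ} (G : SimpleGraph (Fin n)) (k : ℕ) : RAM.State where
  reg r := if r = 0 then n else if r = 1 then k else 0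
  mem a := if ∃ i j : Fin n, a = (i : ℕ) * n + (j : ℕ) ∧ G.Adj i j then 1 else 0

/-- The final state `s` holds a correct answer on input `(G, k)`. Register `0` holds the kind
of the answer:
* `0`: `G` has no `k`-excluding vertex;
* `1`: the vertex in register `1` is not in any `k`-clique;
* `2`: the vertex in register `1` is not in any `k`-independent set. -/
def IsCorrectAnswer {n : ℕ} (G : SimpleGraph (Fin n)) (k : ℕ) (s : RAM.State) : Prop :=
  (s.reg 0 = 0 ∧ ∀ v : Fin n, ¬ IsExcluding G k v) ∨
  (s.reg 0 = 1 ∧ ∃ v : Fin n, s.reg 1 = (v : ℕ) ∧ ¬ InClique G k v) ∨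
  (s.reg 0 = 2 ∧ ∃ v : Fin n, s.reg 1 = (v : ℕ) ∧ ¬ InIndepSet G k v)

/-!
Fix `M` of order `1 / δ ^ 2`. The combinatorial substitute for a `k`-clique is a *near-clique*: a
set of at least `k` vertices, each of which misses at most `k / M` others. A near-independent set is
a near-clique of the complement.

Near-cliques can be found. If `v` lies in a `k`-clique `C`, then a list of `4 * M` vertices of `C`
has a common closed neighbourhood in which every vertex of `C` misses at most `k / M` vertices
(`exists_subset_core`). The vertices with this property form the *core* of the list, which is a
near-clique containing `C`. So a vertex `v` that lies in no core with at least `k` vertices, for any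
list of `4 * M` vertices, is in no `k`-clique. The algorithm tests this for all vertices, in `G` and
in the complement of `G`, by running through all `n ^ (4 * M)` lists.

If all vertices pass both tests and `k < M`, then near-cliques are cliques, and there is no
`k`-excluding vertex. For `M ≤ k` it is impossible that all vertices pass
(`lt_card_of_forall_mem_isNearClique`). A near-clique and a near-independent set share at most
`3 * k / M` vertices. Delete near-cliques `Q u` from the vertex set, as long as this deletes more
than `δ * k / 16` vertices at a time, and let `U` be the rest; let `W` be the rest after deleting
near-independent sets in the same way. There are `O(1 / δ)` deletions, so every near-clique lies
almost entirely in `W`, and every near-independent set almost entirely in `U`. Moreover, `Q u` has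
few vertices in `U` if `u ∈ U`, and similarly for `W`. Hence every vertex of `U \ W` has almost `k`
neighbours in `W \ U`, and every vertex of `W \ U` has almost `k` non-neighbours in `U \ W`;
counting the pairs between these two sets shows that they have almost `4 * k` vertices together.

On the machine, the adjacency matrix is only read, and everything else is kept in registers. The
predicate `RAM.Computes` describes programs that evaluate an expression and use the registers from a
given one on as working space, so that such programs can be nested.
-/

/-! ### Near-cliques -/

open Classical in
/-- The vertices of `Q` that are neither equal nor adjacent to `x`. -/
noncomputable def missing {V : Type*} (G : SimpleGraph V) (Q : Finset V) (x : V) : Finset V :=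
  {y ∈ Q | ¬ (x = y ∨ G.Adj x y)}

/-- `Q` has at least `k` vertices, and each of them misses at most `k / M` others. -/
def IsNearClique {V : Type*} (G : SimpleGraph V) (M k : ℕ) (Q : Finset V) : Prop :=
  k ≤ Q.card ∧ ∀ x ∈ Q, M * (missing G Q x).card ≤ k

open Classical in
/-- The common closed neighbourhood of the vertices in the list `S`. -/
noncomputable def commonNbhd {V : Type*} [Fintype V] (G : SimpleGraph V) (S : List V) :
    Finset V :=
  {y | ∀ s ∈ S, s = y ∨ G.Adj s y}

open Classical in
/-- The vertices of the common closed neighbourhood of `S` that miss at most `k / M` of it. -/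
noncomputable def core {V : Type*} [Fintype V] (G : SimpleGraph V) (M k : ℕ) (S : List V) :
    Finset V :=
  {x ∈ commonNbhd G S | M * (missing G (commonNbhd G S) x).card ≤ k}

section NearClique

variable {V : Type*} {G : SimpleGraph V} {M k : ℕ}

theorem mem_missing {Q : Finset V} {x y : V} :
    y ∈ missing G Q x ↔ y ∈ Q ∧ ¬ (x = y ∨ G.Adj x y) := by
  classical
  exact Finset.mem_filter

theorem mem_core [Fintype V] {S : List V} {x : V} :
    x ∈ core G M k S ↔
      x ∈ commonNbhd G S ∧ M * (missing G (commonNbhd G S) x).card ≤ k := by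
  classical
  exact Finset.mem_filter

theorem missing_mono {Q Q' : Finset V} (h : Q ⊆ Q') (x : V) :
    missing G Q x ⊆ missing G Q' x := by
  classical
  exact Finset.filter_subset_filter _ h

theorem isNearClique_core [Fintype V] {S : List V} (h : k ≤ (core G M k S).card) :
    IsNearClique G M k (core G M k S) := by
  classical
  refine ⟨h, fun x hx => ?_⟩
  have hx' := (Finset.mem_filter.1 hx).2
  refine le_trans (Nat.mul_le_mul_left M (Finset.card_le_card (missing_mono ?_ x))) hx'
  exact Finset.filter_subset _ _

theorem SimpleGraph.IsNClique.isNearClique {Q : Finset V} (h : G.IsNClique k Q) :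
    IsNearClique G M k Q := by
  classical
  refine ⟨h.card_eq.ge, fun x hx => ?_⟩
  have : missing G Q x = ∅ := by
    refine Finset.filter_eq_empty_iff.2 fun y hy hxy => hxy ?_
    by_cases e : x = y
    · exact Or.inl e
    · exact Or.inr (h.isClique hx hy e)
  simp [this]

/-- For `k < M` the bound `k / M` on the number of missed vertices is less than one. -/
theorem IsNearClique.inClique {Q : Finset V} (h : IsNearClique G M k Q) (hkM : k < M)
    (hk : 1 ≤ k) {v : V} (hv : v ∈ Q) : InClique G k v := by
  classical
  have hQ : G.IsClique Q := by
    intro x hx y hy hxy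
    by_contra hadj
    have hmem : y ∈ missing G Q x := Finset.mem_filter.2 ⟨hy, by tauto⟩
    have h1 : 1 ≤ (missing G Q x).card := Finset.card_pos.2 ⟨y, hmem⟩
    have h2 := h.2 x hx
    have h3 := Nat.mul_le_mul_left M h1
    omega
  obtain ⟨S, hvS, hSQ, hS⟩ := Finset.exists_subsuperset_card_eq
    (Finset.singleton_subset_iff.2 hv) (by simpa using hk) h.1
  exact ⟨S, Finset.singleton_subset_iff.1 hvS, hQ.subset (by exact_mod_cast hSQ), hS⟩

/-- Inside a `k`-clique `C`, add vertices to `S` as long as some vertex of `C` misses more than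
`k / M` of the common neighbourhood of `S`. Every addition shrinks that neighbourhood by more
than `k / M`, so that `4 * M` additions suffice. -/
theorem exists_subset_core [Fintype V] {C : Finset V} (hC : G.IsNClique k C) (hk : 1 ≤ k)
    (hn : Fintype.card V ≤ 4 * k) (hM : 1 ≤ M) :
    ∃ S : List V, S.length = 4 * M ∧ C ⊆ core G M k S := by
  classical
  have hsub : ∀ S : List V, (∀ s ∈ S, s ∈ C) → C ⊆ commonNbhd G S := by
    intro S hS y hy
    refine Finset.mem_filter.2 ⟨Finset.mem_univ _, fun s hs => ?_⟩
    by_cases e : s = y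
    · exact Or.inl e
    · exact Or.inr (hC.isClique (hS s hs) hy e)
  have hcons : ∀ (x : V) (S : List V),
      commonNbhd G (x :: S) = commonNbhd G S \ missing G (commonNbhd G S) x := by
    intro x S
    ext y
    simp only [commonNbhd, missing, Finset.mem_filter, Finset.mem_univ, true_and,
      List.mem_cons, forall_eq_or_imp, Finset.mem_sdiff]
    tauto
  have key : ∀ j : ℕ, ∃ S : List V, S.length = j ∧ (∀ s ∈ S, s ∈ C) ∧
      ((∀ x ∈ C, M * (missing G (commonNbhd G S) x).card ≤ k) ∨
        M * (commonNbhd G S).card + j * (k + 1) ≤ M * Fintype.card V) := by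
    intro j
    induction j with
    | zero =>
      refine ⟨[], rfl, by simp, Or.inr ?_⟩
      simpa using Nat.mul_le_mul_left M (Finset.card_le_univ _)
    | succ j ih =>
      obtain ⟨S, hlen, hSC, h⟩ := ih
      by_cases hgood : ∀ x ∈ C, M * (missing G (commonNbhd G S) x).card ≤ k
      · obtain ⟨c, hc⟩ : C.Nonempty := Finset.card_pos.1 (by rw [hC.card_eq]; omega)
        refine ⟨c :: S, by simp [hlen], by simpa [hc] using hSC, Or.inl fun x hx => ?_⟩
        refine le_trans (Nat.mul_le_mul_left M (Finset.card_le_card (missing_mono ?_ x)))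
          (hgood x hx)
        rw [hcons]
        exact Finset.sdiff_subset
      · have h' := h.resolve_left hgood
        push Not at hgood
        obtain ⟨x, hx, hxk⟩ := hgood
        refine ⟨x :: S, by simp [hlen], by simpa [hx] using hSC, Or.inr ?_⟩
        have hle : missing G (commonNbhd G S) x ⊆ commonNbhd G S := Finset.filter_subset _ _
        have hcard := Finset.card_sdiff_add_card_eq_card hle
        rw [← hcons] at hcard
        rw [← hcard] at h'
        nlinarith
  obtain ⟨S, hlen, hSC, h⟩ := key (4 * M)
  refine ⟨S, hlen, fun x hx => Finset.mem_filter.2 ⟨hsub S hSC hx, ?_⟩⟩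
  rcases h with h | h
  · exact h x hx
  · exfalso
    have := Nat.mul_le_mul_left M hn
    nlinarith

/-- Any vertex of a near-clique and a near-independent set misses every other common vertex in one
of the two. -/
theorem IsNearClique.card_inter_le [DecidableEq V] {Q J : Finset V} (hQ : IsNearClique G M k Q)
    (hJ : IsNearClique Gᶜ M k J) : M * (Q ∩ J).card ≤ 2 * k + M := by
  classical
  rcases (Q ∩ J).eq_empty_or_nonempty with h | ⟨x, hx⟩
  · simp [h]
  rw [Finset.mem_inter] at hx
  have hsub : Q ∩ J ⊆ insert x (missing G Q x ∪ missing Gᶜ J x) := by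
    intro y hy
    rw [Finset.mem_inter] at hy
    simp only [missing, Finset.mem_insert, Finset.mem_union, Finset.mem_filter, hy.1, hy.2,
      true_and, SimpleGraph.compl_adj]
    by_cases e : y = x
    · exact Or.inl e
    · have : x ≠ y := Ne.symm e
      tauto
  have h1 := Finset.card_le_card hsub
  have h2 := Finset.card_insert_le x (missing G Q x ∪ missing Gᶜ J x)
  have h3 := Finset.card_union_le (missing G Q x) (missing Gᶜ J x)
  have h4 := hQ.2 x hx.1
  have h5 := hJ.2 x hx.2
  calc M * (Q ∩ J).card
      ≤ M * ((missing G Q x).card + (missing Gᶜ J x).card + 1) := Nat.mul_le_mul_left M (by omega)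
    _ ≤ 2 * k + M := by nlinarith

end NearClique

/-! ### The extremal bound -/

/-- Greedy removal: starting from all vertices, delete sets `Q u` as long as this deletes more
than `g` vertices. A set `J` that meets every `Q u` in at most `c` vertices survives up to `c`
vertices for each deletion. -/
theorem exists_greedy_remainder {V : Type*} [Fintype V] [DecidableEq V] (Q : V → Finset V)
    (𝒥 : Set (Finset V)) {g c : ℝ} (hg : 0 ≤ g)
    (hQ : ∀ u, ∀ J ∈ 𝒥, ((Q u ∩ J).card : ℝ) ≤ c) :
    ∃ (U : Finset V) (s : ℕ), s * g ≤ Fintype.card V ∧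
      (∀ u ∈ U, ((Q u ∩ U).card : ℝ) ≤ g) ∧ ∀ J ∈ 𝒥, ((J \ U).card : ℝ) ≤ s * c := by
  have key : ∀ (N : ℕ) (U : Finset V) (s : ℕ), U.card ≤ N →
      s * g + U.card ≤ Fintype.card V → (∀ J ∈ 𝒥, ((J \ U).card : ℝ) ≤ s * c) →
      ∃ (U : Finset V) (s : ℕ), s * g ≤ Fintype.card V ∧
        (∀ u ∈ U, ((Q u ∩ U).card : ℝ) ≤ g) ∧ ∀ J ∈ 𝒥, ((J \ U).card : ℝ) ≤ s * c := by
    intro N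
    induction N with
    | zero =>
      intro U s hU hs hJ
      obtain rfl : U = ∅ := Finset.card_eq_zero.1 (by omega)
      exact ⟨∅, s, by simpa using hs, by simp, hJ⟩
    | succ N ih =>
      intro U s hU hs hJ
      by_cases hsmall : ∀ u ∈ U, ((Q u ∩ U).card : ℝ) ≤ g
      · exact ⟨U, s, by linarith [(Nat.cast_nonneg U.card : (0 : ℝ) ≤ _)], hsmall, hJ⟩
      · push Not at hsmall
        obtain ⟨u, -, hu⟩ := hsmall
        have hcard : (U \ Q u).card + (Q u ∩ U).card = U.card := by
          rw [Finset.inter_comm]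
          exact Finset.card_sdiff_add_card_inter U (Q u)
        have hpos : 0 < (Q u ∩ U).card := by
          have : (0 : ℝ) < (Q u ∩ U).card := by linarith
          exact_mod_cast this
        have hcard' : ((U \ Q u).card : ℝ) + (Q u ∩ U).card = U.card := by exact_mod_cast hcard
        refine ih (U \ Q u) (s + 1) (by omega) (by push_cast; linarith) fun J hJ' => ?_
        have hsub : J \ (U \ Q u) ⊆ (J \ U) ∪ (Q u ∩ J) := by
          intro y
          simp only [Finset.mem_sdiff, Finset.mem_union, Finset.mem_inter]
          tauto
        have h1 := (Finset.card_le_card hsub).trans (Finset.card_union_le _ _)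
        have h2 : ((J \ (U \ Q u)).card : ℝ) ≤ (J \ U).card + (Q u ∩ J).card := by
          exact_mod_cast h1
        push_cast
        linarith [hQ u J hJ', hJ J hJ']
  refine key _ Finset.univ 0 le_rfl (by simp) (by simp)

/-- If every vertex of a nonempty set `B` has at least `d` neighbours in `A`, and every vertex of
`A` has at least `d` non-neighbours in `B`, then `A` and `B` have at least `4 * d` vertices
together: there are at least `d * (|A| + |B|)` and exactly `|A| * |B|` pairs. -/
theorem four_mul_le_card_add_card {V : Type*} (R : V → V → Prop) {A B : Finset V} {d : ℝ}
    [DecidableRel R] (hB : B.Nonempty) (hBd : ∀ b ∈ B, d ≤ ({a ∈ A | R a b} : Finset V).card)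
    (hAd : ∀ a ∈ A, d ≤ ({b ∈ B | ¬ R a b} : Finset V).card) :
    4 * d ≤ A.card + B.card := by
  have h1 : (B.card : ℝ) * d ≤ ∑ b ∈ B, (({a ∈ A | R a b} : Finset V).card : ℝ) := by
    rw [← nsmul_eq_mul]
    exact Finset.card_nsmul_le_sum _ _ _ hBd
  have h2 : (A.card : ℝ) * d ≤ ∑ a ∈ A, (({b ∈ B | ¬ R a b} : Finset V).card : ℝ) := by
    rw [← nsmul_eq_mul]
    exact Finset.card_nsmul_le_sum _ _ _ hAd
  have h3 : ∑ b ∈ B, ({a ∈ A | R a b} : Finset V).card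
      = ∑ a ∈ A, ({b ∈ B | R a b} : Finset V).card :=
    (Finset.sum_card_bipartiteAbove_eq_sum_card_bipartiteBelow R).symm
  have h4 : ∑ a ∈ A, ({b ∈ B | R a b} : Finset V).card
      + ∑ a ∈ A, ({b ∈ B | ¬ R a b} : Finset V).card = A.card * B.card := by
    rw [← Finset.sum_add_distrib]
    simp [Finset.card_filter_add_card_filter_not]
  have h5 : (A.card : ℝ) * d + B.card * d ≤ A.card * B.card := by
    have h4' : ∑ a ∈ A, (({b ∈ B | R a b} : Finset V).card : ℝ)
        + ∑ a ∈ A, (({b ∈ B | ¬ R a b} : Finset V).card : ℝ) = A.card * B.card := by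
      exact_mod_cast h4
    have h3' : ∑ b ∈ B, (({a ∈ A | R a b} : Finset V).card : ℝ)
        = ∑ a ∈ A, (({b ∈ B | R a b} : Finset V).card : ℝ) := by exact_mod_cast h3
    linarith
  have hpos : (0 : ℝ) < B.card := by exact_mod_cast Finset.card_pos.2 hB
  have hA : (0 : ℝ) ≤ A.card := Nat.cast_nonneg _
  by_contra hlt
  push Not at hlt
  nlinarith [sq_nonneg ((A.card : ℝ) - B.card)]

/-- In a graph all of whose vertices lie in a near-clique and in a near-independent set, there
are more than `(4 - δ) * k` vertices, provided that `M` is at least of the order of `1 / δ ^ 2`. -/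
theorem lt_card_of_forall_mem_isNearClique {V : Type*} [Fintype V] [Nonempty V]
    {G : SimpleGraph V} {M k : ℕ} {δ : ℝ} (hδ : 0 < δ) (hδ1 : δ < 1) (hM : 3072 ≤ δ ^ 2 * M)
    (hMk : M ≤ k) (hQ : ∀ v, ∃ Q, v ∈ Q ∧ IsNearClique G M k Q)
    (hJ : ∀ v, ∃ J, v ∈ J ∧ IsNearClique Gᶜ M k J) :
    (4 - δ) * k < Fintype.card V := by
  classical
  choose Q hvQ hQ using hQ
  choose J hvJ hJ using hJ
  by_contra! hn
  have hM0 : (0 : ℝ) < M := by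
    by_contra! h
    nlinarith [sq_nonneg δ]
  have hMk' : (M : ℝ) ≤ k := by exact_mod_cast hMk
  have hk0 : (0 : ℝ) < k := by linarith
  set x : ℝ := k / M with hx
  have hMx : M * x = k := by rw [hx]; field_simp
  have hx1 : 1 ≤ x := by rw [hx, le_div_iff₀ hM0]; linarith
  have hmiss : ∀ {H : SimpleGraph V} {P : Finset V}, IsNearClique H M k P → ∀ v ∈ P,
      ((missing H P v).card : ℝ) ≤ x := by
    intro H P hP v hv
    rw [hx, le_div_iff₀ hM0, mul_comm]
    exact_mod_cast hP.2 v hv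
  have hinter : ∀ P R, IsNearClique G M k P → IsNearClique Gᶜ M k R →
      ((P ∩ R).card : ℝ) ≤ 3 * x := by
    intro P R hP hR
    have h := hP.card_inter_le hR
    have h' : (M : ℝ) * (P ∩ R).card ≤ 2 * k + M := by exact_mod_cast h
    rw [hx, ← mul_div_assoc, le_div_iff₀ hM0]
    linarith
  -- Each deletion removes more than `g` of at most `4 * k` vertices, so there are at most
  -- `64 / δ` of them, and together they cost any near-clique at most `g` vertices.
  set g : ℝ := δ / 16 * k with hg
  have hg0 : 0 < g := by positivity
  have hloss : ∀ s : ℕ, s * g ≤ Fintype.card V → s * (3 * x) ≤ g := by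
    intro s hs
    have h1 : (s : ℝ) * δ ≤ 64 := by
      have : (s : ℝ) * δ * k ≤ 64 * k := by rw [hg] at hs; nlinarith
      exact le_of_mul_le_mul_right this hk0
    have h2 : (s : ℝ) * 48 * δ ≤ δ * M * δ := by
      calc (s : ℝ) * 48 * δ ≤ 3072 := by linarith
        _ ≤ δ ^ 2 * M := hM
        _ = δ * M * δ := by ring
    have h3 : (s : ℝ) * 48 ≤ δ * M := le_of_mul_le_mul_right h2 hδ
    rw [hg, ← hMx]
    nlinarith
  obtain ⟨U, s, hs, hU, hJU⟩ := exists_greedy_remainder Q {R | IsNearClique Gᶜ M k R} hg0.le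
    (fun u R hR => hinter (Q u) R (hQ u) hR)
  obtain ⟨W, t, ht, hW, hQW⟩ := exists_greedy_remainder J {P | IsNearClique G M k P} hg0.le
    (fun u P hP => by rw [Finset.inter_comm]; exact hinter P (J u) hP (hJ u))
  have hxg : x ≤ g := by
    rw [hg, ← hMx]
    have : 16 ≤ δ * M := by nlinarith
    nlinarith
  have hgk : 4 * g < k := by rw [hg]; nlinarith
  have hsplit : ∀ (P X Y : Finset V), (k : ℝ) ≤ P.card → ((P \ X).card : ℝ) ≤ g →
      ((P ∩ Y).card : ℝ) ≤ g → k - 2 * g ≤ ((P ∩ (X \ Y)).card : ℝ) := by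
    intro P X Y hP hX hY
    have hsub : P ⊆ (P \ X) ∪ (P ∩ Y) ∪ (P ∩ (X \ Y)) := by
      intro y
      simp only [Finset.mem_sdiff, Finset.mem_union, Finset.mem_inter]
      tauto
    have h1 := Finset.card_le_card hsub
    have h2 := Finset.card_union_le ((P \ X) ∪ (P ∩ Y)) (P ∩ (X \ Y))
    have h3 := Finset.card_union_le (P \ X) (P ∩ Y)
    have h4 : (P.card : ℝ) ≤ (P \ X).card + (P ∩ Y).card + (P ∩ (X \ Y)).card := by
      exact_mod_cast (by omega : P.card ≤ (P \ X).card + (P ∩ Y).card + (P ∩ (X \ Y)).card)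
    linarith
  have hcardQ : ∀ v, (k : ℝ) ≤ (Q v).card := fun v => by exact_mod_cast (hQ v).1
  have hcardJ : ∀ v, (k : ℝ) ≤ (J v).card := fun v => by exact_mod_cast (hJ v).1
  have hQA : ∀ u ∈ U, k - 2 * g ≤ ((Q u ∩ (W \ U)).card : ℝ) := fun u hu =>
    hsplit _ _ _ (hcardQ u) ((hQW (Q u) (hQ u)).trans (hloss t ht)) (hU u hu)
  have hJB : ∀ w ∈ W, k - 2 * g ≤ ((J w ∩ (U \ W)).card : ℝ) := fun w hw =>
    hsplit _ _ _ (hcardJ w) ((hJU (J w) (hJ w)).trans (hloss s hs)) (hW w hw)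
  have hWne : W.Nonempty := by
    rw [Finset.nonempty_iff_ne_empty]
    rintro rfl
    obtain ⟨v⟩ := ‹Nonempty V›
    have h1 := (hQW (Q v) (hQ v)).trans (hloss t ht)
    rw [Finset.sdiff_empty] at h1
    linarith [hcardQ v]
  have hBne : (U \ W).Nonempty := by
    obtain ⟨w, hw⟩ := hWne
    have h1 := hJB w hw
    have h2 : (0 : ℝ) < (J w ∩ (U \ W)).card := by linarith
    have h3 : 0 < (J w ∩ (U \ W)).card := by exact_mod_cast h2
    exact (Finset.card_pos.1 h3).mono Finset.inter_subset_right
  have hfin := four_mul_le_card_add_card (A := W \ U) (B := U \ W) (d := k - 3 * g) G.Adj hBne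
    (by
      intro b hb
      rw [Finset.mem_sdiff] at hb
      have hsub : Q b ∩ (W \ U) ⊆ {a ∈ W \ U | G.Adj a b} ∪ missing G (Q b) b := by
        intro y hy
        simp only [missing, Finset.mem_union, Finset.mem_filter, Finset.mem_inter] at hy ⊢
        have hne : b ≠ y := by
          rintro rfl
          exact (Finset.mem_sdiff.1 hy.2).2 hb.1
        rw [G.adj_comm y b]
        tauto
      have h1 := (Finset.card_le_card hsub).trans (Finset.card_union_le _ _)
      have h2 : ((Q b ∩ (W \ U)).card : ℝ)
          ≤ ({a ∈ W \ U | G.Adj a b} : Finset V).card + (missing G (Q b) b).card := by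
        exact_mod_cast h1
      linarith [hQA b hb.1, hmiss (hQ b) b (hvQ b)])
    (by
      intro a ha
      rw [Finset.mem_sdiff] at ha
      have hsub : J a ∩ (U \ W) ⊆ {b ∈ U \ W | ¬ G.Adj a b} ∪ missing Gᶜ (J a) a := by
        intro y hy
        simp only [missing, Finset.mem_union, Finset.mem_filter, Finset.mem_inter,
          SimpleGraph.compl_adj] at hy ⊢
        have hne : a ≠ y := by
          rintro rfl
          exact (Finset.mem_sdiff.1 hy.2).2 ha.1
        tauto
      have h1 := (Finset.card_le_card hsub).trans (Finset.card_union_le _ _)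
      have h2 : ((J a ∩ (U \ W)).card : ℝ)
          ≤ ({b ∈ U \ W | ¬ G.Adj a b} : Finset V).card + (missing Gᶜ (J a) a).card := by
        exact_mod_cast h1
      linarith [hJB a ha.1, hmiss (hJ a) a (hvJ a)])
  have hdisj : Disjoint (W \ U) (U \ W) := disjoint_sdiff_sdiff
  have hcard : (W \ U).card + (U \ W).card ≤ Fintype.card V := by
    rw [← Finset.card_union_of_disjoint hdisj]
    exact Finset.card_le_univ _
  have hcard' : ((W \ U).card : ℝ) + (U \ W).card ≤ Fintype.card V := by exact_mod_cast hcard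
  have : 4 * (k - 3 * g) ≤ (4 - δ) * k := by linarith
  rw [hg] at this
  nlinarith

/-! ### Programs that only read the memory -/

namespace RAM

/-- Started with registers `ρ` and memory `m`, the program `P` halts after at most `T` steps, with
the memory unchanged and registers that satisfy `post`. -/
def Achieves (m : ℕ → ℕ) (P : Program) (ρ : ℕ → ℕ) (T : ℕ) (post : (ℕ → ℕ) → Prop) : Prop :=
  ∃ t ρ', t ≤ T ∧ Runs P ⟨ρ, m⟩ t ⟨ρ', m⟩ ∧ post ρ'

section Achieves

variable {m ρ : ℕ → ℕ} {P Q : Program} {T T' : ℕ} {post post' : (ℕ → ℕ) → Prop}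

theorem Achieves.mono (h : Achieves m P ρ T post) (hT : T ≤ T')
    (hp : ∀ ρ', post ρ' → post' ρ') : Achieves m P ρ T' post' := by
  obtain ⟨t, ρ', ht, hr, h⟩ := h
  exact ⟨t, ρ', ht.trans hT, hr, hp _ h⟩

theorem Achieves.seq (h : Achieves m P ρ T post)
    (h' : ∀ ρ', post ρ' → Achieves m Q ρ' T' post') :
    Achieves m (.seq P Q) ρ (T + T') post' := by
  obtain ⟨t, ρ', ht, hr, h⟩ := h
  obtain ⟨t', ρ'', ht', hr', h''⟩ := h' ρ' h
  exact ⟨t + t', ρ'', by omega, .seq hr hr', h''⟩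

theorem achieves_skip (h : post ρ) : Achieves m .skip ρ 1 post :=
  ⟨1, _, le_rfl, .skip _, h⟩

theorem achieves_const {r c : ℕ} (h : post (Function.update ρ r c)) :
    Achieves m (.const r c) ρ 1 post :=
  ⟨1, _, le_rfl, .const _ r c, h⟩

theorem achieves_add {r a b : ℕ} (h : post (Function.update ρ r (ρ a + ρ b))) :
    Achieves m (.add r a b) ρ 1 post :=
  ⟨1, _, le_rfl, .add _ r a b, h⟩

theorem achieves_sub {r a b : ℕ} (h : post (Function.update ρ r (ρ a - ρ b))) :
    Achieves m (.sub r a b) ρ 1 post :=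
  ⟨1, _, le_rfl, .sub _ r a b, h⟩

theorem achieves_load {r a : ℕ} (h : post (Function.update ρ r (m (ρ a)))) :
    Achieves m (.load r a) ρ 1 post :=
  ⟨1, _, le_rfl, .load _ r a, h⟩

theorem achieves_branch {a b : ℕ} (hP : ρ a < ρ b → Achieves m P ρ T post)
    (hQ : ¬ ρ a < ρ b → Achieves m Q ρ T post) : Achieves m (.branch a b P Q) ρ (T + 1) post := by
  by_cases h : ρ a < ρ b
  · obtain ⟨t, ρ', ht, hr, hp⟩ := hP h
    exact ⟨t + 1, ρ', by omega, .branch_true h hr, hp⟩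
  · obtain ⟨t, ρ', ht, hr, hp⟩ := hQ h
    exact ⟨t + 1, ρ', by omega, .branch_false h hr, hp⟩

/-- The rule for counting loops: register `c` runs from `x` to `x + N`, the value of register
`b`. -/
theorem achieves_loop {c b : ℕ} {inv : ℕ → (ℕ → ℕ) → Prop} {n : ℕ}
    (hc : ∀ x ρ, inv x ρ → ρ c = x ∧ ρ b = n)
    (hP : ∀ x ρ, x < n → inv x ρ → Achieves m P ρ T (inv (x + 1))) (N x : ℕ) (hx : x + N = n)
    (h : inv x ρ) : Achieves m (.loop c b P) ρ (N * (T + 1) + 1) (inv n) := by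
  induction N generalizing x ρ with
  | zero =>
    obtain ⟨h1, h2⟩ := hc _ _ h
    obtain rfl : x = n := by omega
    exact ⟨1, ρ, by omega, .loop_done (by simp [h1, h2]), h⟩
  | succ N ih =>
    obtain ⟨h1, h2⟩ := hc _ _ h
    obtain ⟨t, ρ', ht, hr, hp⟩ := hP x ρ (by omega) h
    obtain ⟨t', ρ'', ht', hr', hp'⟩ := ih (x + 1) (by omega) hp
    refine ⟨t + t' + 1, ρ'', ?_, .loop_step (by simp only [h1, h2]; omega) hr hr', hp'⟩
    rw [Nat.succ_mul]
    omega

end Achieves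

/-! ### Programs that evaluate expressions -/

/-- On registers that agree with `ρ₀` below `d`, the program `P` leaves a value satisfying `post`
in register `d`, and does not change the registers below `d`. It may use all registers from `d`
on as working space. A register holds the truth value of a proposition `φ` if it is positive
exactly when `φ` holds. -/
def Computes (m : ℕ → ℕ) (P : Program) (d : ℕ) (ρ₀ : ℕ → ℕ) (post : ℕ → Prop) (T : ℕ) : Prop :=
  ∀ ρ, (∀ i < d, ρ i = ρ₀ i) →
    Achieves m P ρ T fun ρ' => (∀ i < d, ρ' i = ρ₀ i) ∧ post (ρ' d)

/-- Conjunction of two tests. -/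
def andProg (P Q : Program) (d : ℕ) : Program :=
  .seq P (.seq (.const (d + 1) 0) (.branch (d + 1) d Q .skip))

/-- Negation of a test. -/
def notProg (P : Program) (d : ℕ) : Program :=
  .seq P (.seq (.const (d + 1) 1) (.sub d (d + 1) d))

/-- The test whether the value computed by `P` is at most the value of register `b`. -/
def leProg (P : Program) (b d : ℕ) : Program :=
  .seq P (.seq (.const (d + 1) 1) (.seq (.add (d + 1) (d + 1) b) (.sub d (d + 1) d)))

/-- The test whether the value computed by `P` is at least the value of register `b`. -/
def geProg (P : Program) (b d : ℕ) : Program :=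
  .seq P (.seq (.const (d + 1) 1) (.seq (.add d d (d + 1)) (.sub d d b)))

/-- The sum of `w` over the numbers below the value of register `0` that pass the test `P`, which
finds the number in register `d + 1` and leaves its result in register `d + 2`. -/
def sumProg (w : ℕ) (P : Program) (d : ℕ) : Program :=
  .seq (.const d 0) (.seq (.const (d + 1) 0) (.loop (d + 1) 0
    (.seq P (.seq (.const (d + 3) 0) (.seq
      (.branch (d + 3) (d + 2) (.seq (.const (d + 3) w) (.add d d (d + 3))) .skip)
      (.seq (.const (d + 3) 1) (.add (d + 1) (d + 1) (d + 3))))))))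

section Computes

variable {m ρ₀ : ℕ → ℕ} {P Q : Program} {d T T' : ℕ}

theorem Computes.mono {post post' : ℕ → Prop} (h : Computes m P d ρ₀ post T) (hT : T ≤ T')
    (hp : ∀ x, post x → post' x) : Computes m P d ρ₀ post' T' :=
  fun ρ hρ => (h ρ hρ).mono hT fun _ h => ⟨h.1, hp _ h.2⟩

theorem computes_const (c : ℕ) : Computes m (.const d c) d ρ₀ (· = c) 1 := fun ρ hρ =>
  achieves_const ⟨fun i hi => by rw [Function.update_of_ne hi.ne]; exact hρ i hi, by simp⟩

theorem Computes.and {φ ψ : Prop} (hP : Computes m P d ρ₀ (0 < · ↔ φ) T)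
    (hQ : φ → Computes m Q d ρ₀ (0 < · ↔ ψ) T') :
    Computes m (andProg P Q d) d ρ₀ (0 < · ↔ φ ∧ ψ) (T + T' + 3) := by
  intro ρ hρ
  refine ((hP ρ hρ).seq (T' := 1 + (T' + 1 + 1)) fun ρ' h => ?_).mono (by omega) fun _ h => h
  refine (achieves_const (post := (· = Function.update ρ' (d + 1) 0)) rfl).seq ?_
  rintro _ rfl
  have hlow : ∀ i < d, Function.update ρ' (d + 1) 0 i = ρ₀ i := fun i hi => by
    rw [Function.update_of_ne (by omega)]
    exact h.1 i hi
  have hd : Function.update ρ' (d + 1) 0 d = ρ' d := Function.update_of_ne (by omega) _ _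
  refine achieves_branch (fun hlt => ?_) (fun hlt => ?_)
  · rw [hd, Function.update_self] at hlt
    have hφ := h.2.1 hlt
    exact (hQ hφ _ hlow).mono (by omega) fun _ h => ⟨h.1, by simpa [hφ] using h.2⟩
  · rw [hd, Function.update_self] at hlt
    have hφ : ¬ φ := fun hφ => hlt (h.2.2 hφ)
    exact (achieves_skip ⟨hlow, by rw [hd]; simp [hφ, hlt]⟩).mono (by omega) fun _ h => h

theorem Computes.not {φ : Prop} (hP : Computes m P d ρ₀ (0 < · ↔ φ) T) :
    Computes m (notProg P d) d ρ₀ (0 < · ↔ ¬ φ) (T + 2) := by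
  intro ρ hρ
  refine (hP ρ hρ).seq (T' := 2) fun ρ' h => ?_
  refine (achieves_const (post := (· = Function.update ρ' (d + 1) 1)) rfl).seq (T' := 1) ?_
  rintro _ rfl
  refine achieves_sub ⟨fun i hi => ?_, ?_⟩
  · rw [Function.update_of_ne (by omega), Function.update_of_ne (by omega)]
    exact h.1 i hi
  · have hφ : 0 < ρ' d ↔ φ := h.2
    rw [← hφ, Function.update_self, Function.update_self, Function.update_of_ne (by omega)]
    omega

theorem Computes.le {v b : ℕ} (hb : b < d) (hP : Computes m P d ρ₀ (· = v) T) :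
    Computes m (leProg P b d) d ρ₀ (0 < · ↔ v ≤ ρ₀ b) (T + 3) := by
  intro ρ hρ
  refine (hP ρ hρ).seq (T' := 3) fun ρ' h => ?_
  refine (achieves_const (post := (· = Function.update ρ' (d + 1) 1)) rfl).seq (T' := 2) ?_
  rintro _ rfl
  refine (achieves_add (post := (· = Function.update ρ' (d + 1) (1 + ρ₀ b))) ?_).seq (T' := 1) ?_
  · rw [Function.update_self, Function.update_of_ne (by omega), Function.update_idem, h.1 b hb]
  rintro _ rfl
  refine achieves_sub ⟨fun i hi => ?_, ?_⟩
  · rw [Function.update_of_ne (by omega), Function.update_of_ne (by omega)]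
    exact h.1 i hi
  · rw [Function.update_self, Function.update_self, Function.update_of_ne (by omega), h.2]
    omega

theorem Computes.ge {v b : ℕ} (hb : b < d) (hP : Computes m P d ρ₀ (· = v) T) :
    Computes m (geProg P b d) d ρ₀ (0 < · ↔ ρ₀ b ≤ v) (T + 3) := by
  intro ρ hρ
  refine (hP ρ hρ).seq (T' := 3) fun ρ' h => ?_
  refine (achieves_const (post := (· = Function.update ρ' (d + 1) 1)) rfl).seq (T' := 2) ?_
  rintro _ rfl
  refine (achieves_add (post := (· = Function.update (Function.update ρ' (d + 1) 1) d (v + 1)))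
    ?_).seq (T' := 1) ?_
  · rw [Function.update_self, Function.update_of_ne (by omega), h.2]
  rintro _ rfl
  refine achieves_sub ⟨fun i hi => ?_, ?_⟩
  · rw [Function.update_of_ne (by omega), Function.update_of_ne (by omega),
      Function.update_of_ne (by omega)]
    exact h.1 i hi
  · rw [Function.update_self, Function.update_self, Function.update_of_ne (by omega),
      Function.update_of_ne (by omega), h.1 b hb]
    omega

open Classical in
theorem Computes.sum {n : ℕ} {φ : Fin n → Prop} (w : ℕ) (hd : 0 < d) (hn : ρ₀ 0 = n)
    (hP : ∀ (acc : ℕ) (x : Fin n),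
      Computes m P (d + 2) (Function.update (Function.update ρ₀ d acc) (d + 1) x)
        (0 < · ↔ φ x) T) :
    Computes m (sumProg w P d) d ρ₀ (· = w * ({x | φ x} : Finset (Fin n)).card)
      (n * (T + 8) + 3) := by
  intro ρ hρ
  let part (x : ℕ) : Finset (Fin n) := {y | (y : ℕ) < x ∧ φ y}
  let inv (x : ℕ) (ρ : ℕ → ℕ) : Prop :=
    (∀ i < d, ρ i = ρ₀ i) ∧ ρ (d + 1) = x ∧ ρ d = w * (part x).card
  have hloop : ∀ ρ, inv 0 ρ → Achieves m _ ρ _ (inv n) := fun ρ h =>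
    achieves_loop (c := d + 1) (b := 0) (inv := inv) (n := n) (T := T + 7)
      (P := .seq P (.seq (.const (d + 3) 0) (.seq
        (.branch (d + 3) (d + 2) (.seq (.const (d + 3) w) (.add d d (d + 3))) .skip)
        (.seq (.const (d + 3) 1) (.add (d + 1) (d + 1) (d + 3))))))
      (fun x ρ h => ⟨h.2.1, by rw [h.1 0 hd, hn]⟩)
      (by
        intro x ρ hx h
        obtain ⟨h1, h2, h3⟩ := h
        have hstep : (part (x + 1)).card = (part x).card + if φ ⟨x, hx⟩ then 1 else 0 := by
          have hnot : (⟨x, hx⟩ : Fin n) ∉ part x := by simp [part]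
          split_ifs with hφ
          · rw [← Finset.card_insert_of_notMem hnot]
            congr 1
            ext y
            simp only [part, Finset.mem_filter, Finset.mem_univ, true_and, Finset.mem_insert,
              Fin.ext_iff]
            constructor
            · rintro ⟨hy, hy'⟩
              rcases Nat.lt_succ_iff_lt_or_eq.1 hy with h | h
              · exact Or.inr ⟨h, hy'⟩
              · exact Or.inl h
            · rintro (h | h)
              · obtain rfl : y = ⟨x, hx⟩ := Fin.ext h
                exact ⟨by simp, hφ⟩
              · exact ⟨by omega, h.2⟩
          · rw [add_zero]
            congr 1
            ext y
            simp only [part, Finset.mem_filter, Finset.mem_univ, true_and]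
            constructor
            · rintro ⟨hy, hy'⟩
              refine ⟨?_, hy'⟩
              by_contra hlt
              obtain rfl : y = ⟨x, hx⟩ := Fin.ext (by simp; omega)
              exact hφ hy'
            · exact fun h => ⟨by omega, h.2⟩
        refine ((hP (ρ d) ⟨x, hx⟩ ρ fun i hi => ?_).seq (T' := 7) fun ρ' h => ?_)
        · rcases (by omega : i < d ∨ i = d ∨ i = d + 1) with h | rfl | rfl
          · rw [Function.update_of_ne (by omega), Function.update_of_ne (by omega), h1 i h]
          · rw [Function.update_of_ne (by omega), Function.update_self]
          · rw [Function.update_self, h2]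
        obtain ⟨hlow, hφ⟩ := h
        have k1 : ∀ i < d, ρ' i = ρ₀ i := fun i hi => by
          rw [hlow i (by omega), Function.update_of_ne (by omega),
            Function.update_of_ne (by omega)]
        have k2 : ρ' (d + 1) = x := by rw [hlow _ (by omega), Function.update_self]
        have k3 : ρ' d = w * (part x).card := by
          rw [hlow _ (by omega), Function.update_of_ne (by omega), Function.update_self, h3]
        refine (achieves_const (post := (· = Function.update ρ' (d + 3) 0)) rfl).seq
          (T' := 6) ?_
        rintro _ rfl
        refine Achieves.seq (T := 4) (T' := 2)
          (post := fun ρ => (∀ i < d, ρ i = ρ₀ i) ∧ ρ (d + 1) = x ∧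
            ρ d = w * (part (x + 1)).card) ?_ ?_
        · refine achieves_branch (T := 3) (fun hlt => ?_) (fun hlt => ?_)
          · rw [Function.update_self, Function.update_of_ne (by omega), hφ] at hlt
            refine Achieves.mono (T := 2) ?_ (by omega) fun _ h => h
            refine (achieves_const (post := (· = Function.update ρ' (d + 3) w)) (by simp)).seq
              (T' := 1) ?_
            rintro _ rfl
            refine achieves_add ⟨fun i hi => ?_, ?_, ?_⟩
            · rw [Function.update_of_ne (by omega), Function.update_of_ne (by omega), k1 i hi]
            · rw [Function.update_of_ne (by omega), Function.update_of_ne (by omega), k2]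
            · rw [Function.update_self, Function.update_self, Function.update_of_ne (by omega),
                k3, hstep, if_pos hlt]
              ring
          · rw [Function.update_self, Function.update_of_ne (by omega), hφ] at hlt
            refine Achieves.mono (achieves_skip ⟨fun i hi => ?_, ?_, ?_⟩) (by omega) fun _ h => h
            · rw [Function.update_of_ne (by omega), k1 i hi]
            · rw [Function.update_of_ne (by omega), k2]
            · rw [Function.update_of_ne (by omega), k3, hstep, if_neg hlt, add_zero]
        · rintro ρ'' ⟨l1, l2, l3⟩
          refine (achieves_const (post := (· = Function.update ρ'' (d + 3) 1)) rfl).seq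
            (T' := 1) ?_
          rintro _ rfl
          refine achieves_add ⟨fun i hi => ?_, ?_, ?_⟩
          · rw [Function.update_of_ne (by omega), Function.update_of_ne (by omega), l1 i hi]
          · rw [Function.update_self, Function.update_self, Function.update_of_ne (by omega), l2]
          · rw [Function.update_of_ne (by omega), Function.update_of_ne (by omega), l3])
      n 0 (by omega) h
  have hpart : part n = ({x | φ x} : Finset (Fin n)) := by
    ext y
    simp [part]
  refine Achieves.mono (T := 1 + (1 + (n * (T + 7 + 1) + 1))) (post := inv n) ?_
    (le_of_eq (by ring)) fun ρ' h => ⟨h.1, by rw [h.2.2, hpart]⟩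
  refine (achieves_const (post := (· = Function.update ρ d 0)) rfl).seq ?_
  rintro _ rfl
  refine (achieves_const (post := (· = Function.update (Function.update ρ d 0) (d + 1) 0))
    rfl).seq ?_
  rintro _ rfl
  refine hloop _ ⟨fun i hi => ?_, ?_, ?_⟩
  · rw [Function.update_of_ne (by omega), Function.update_of_ne (by omega), hρ i hi]
  · rw [Function.update_self]
  · rw [Function.update_of_ne (by omega), Function.update_self]
    simp [part]

end Computes

end RAM

/-! ### The test for near-cliques -/

namespace RAM

/-- The test whether the vertices in registers `a` and `b` are equal or adjacent, in the
complement of the input graph if `c` is true and in the input graph itself otherwise. -/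
def edgeProg (c : Bool) (a b d : ℕ) : Program :=
  let readEntry : Program :=
    .seq (.const d 0) (.seq (.const (d + 1) 0) (.seq (.const (d + 2) 1)
      (.seq (.loop (d + 1) a (.seq (.add d d 0) (.add (d + 1) (d + 1) (d + 2))))
        (.seq (.add d d b) (.seq (.load d d) (bif c then .sub d (d + 2) d else .skip))))))
  .branch a b readEntry (.branch b a readEntry (.const d 1))

/-- The test whether the vertex in register `a` belongs to the common closed neighbourhood of the
vertices in the registers `L`. -/
def nbhdProg (c : Bool) : List ℕ → ℕ → ℕ → Program
  | [], _, d => .const d 1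
  | l :: L, a, d => andProg (edgeProg c l a d) (nbhdProg c L a d) d

/-- The test whether the vertex in register `a` belongs to the core of the list of vertices in the
registers `L`. -/
def coreProg (c : Bool) (M : ℕ) (L : List ℕ) (a d : ℕ) : Program :=
  andProg (nbhdProg c L a d)
    (leProg (sumProg M (andProg (nbhdProg c L (d + 1) (d + 2))
      (notProg (edgeProg c a (d + 1) (d + 2)) (d + 2)) (d + 2)) d) 1 d) d

/-- The test whether the core of the list of vertices in the registers `L` contains the vertex in
register `2` and has at least as many vertices as register `1` says. -/
def listProg (c : Bool) (M : ℕ) (L : List ℕ) (d : ℕ) : Program :=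
  andProg (coreProg c M L 2 d) (geProg (sumProg 1 (coreProg c M L (d + 1) (d + 2)) d) 1 d) d

/-- A program whose result is positive exactly if `listProg` succeeds for some extension of the list
in the registers `L` by `r` vertices: nested counting loops, whose counters are the new vertices. -/
def searchProg (c : Bool) (M : ℕ) : ℕ → List ℕ → ℕ → Program
  | 0, L, d => listProg c M L d
  | r + 1, L, d => sumProg 1 (searchProg c M r ((d + 1) :: L) (d + 2)) d

section Search

variable {n k : ℕ} {G : SimpleGraph (Fin n)} {m ρ₀ : ℕ → ℕ} {c : Bool} {d M : ℕ}

theorem computes_edgeProg (hn : ρ₀ 0 = n)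
    (hm : ∀ x y : Fin n, m (x * n + y) = open Classical in if G.Adj x y then 1 else 0) {a b : ℕ}
    (ha : a < d) (hb : b < d) {x y : Fin n} (hx : ρ₀ a = x) (hy : ρ₀ b = y) :
    Computes m (edgeProg c a b d) d ρ₀ (0 < · ↔ x = y ∨ (bif c then Gᶜ else G).Adj x y)
      (12 * n) := by
  classical
  have hn1 : 1 ≤ n := by have := x.2; omega
  intro ρ hρ
  let inv (z : ℕ) (ρ : ℕ → ℕ) : Prop :=
    (∀ i < d, ρ i = ρ₀ i) ∧ ρ (d + 1) = z ∧ ρ (d + 2) = 1 ∧ ρ d = z * n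
  have hread : x ≠ y → Achieves m (.seq (.const d 0) (.seq (.const (d + 1) 0)
      (.seq (.const (d + 2) 1)
      (.seq (.loop (d + 1) a (.seq (.add d d 0) (.add (d + 1) (d + 1) (d + 2))))
        (.seq (.add d d b) (.seq (.load d d) (bif c then .sub d (d + 2) d else .skip)))))))
      ρ (3 * n + 7) fun ρ' => (∀ i < d, ρ' i = ρ₀ i) ∧
        (0 < ρ' d ↔ x = y ∨ (bif c then Gᶜ else G).Adj x y) := by
    intro hxy
    refine Achieves.mono (T := 1 + (1 + (1 + (((x : ℕ) * (2 + 1) + 1) + (1 + (1 + 1))))))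
      ?_ (by have := x.2; omega) fun _ h => h
    refine (achieves_const (post := (· = Function.update ρ d 0)) rfl).seq ?_
    rintro _ rfl
    refine (achieves_const
      (post := (· = Function.update (Function.update ρ d 0) (d + 1) 0)) rfl).seq ?_
    rintro _ rfl
    refine (achieves_const (post := inv 0) ?_).seq fun ρ₁ h₁ => ?_
    · refine ⟨fun i hi => ?_, ?_, ?_, ?_⟩
      · rw [Function.update_of_ne (by omega), Function.update_of_ne (by omega),
          Function.update_of_ne (by omega), hρ i hi]
      · rw [Function.update_of_ne (by omega), Function.update_self]
      · rw [Function.update_self]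
      · rw [Function.update_of_ne (by omega), Function.update_of_ne (by omega),
          Function.update_self, zero_mul]
    refine (achieves_loop (n := x) (inv := inv) (fun z ρ h => ⟨h.2.1, by rw [h.1 a ha, hx]⟩)
      ?_ x 0 (by omega) h₁).seq ?_
    · rintro z ρ₂ - ⟨h1, h2, h3, h4⟩
      refine (achieves_add (post := (· = Function.update ρ₂ d (z * n + n))) ?_).seq (T' := 1) ?_
      · rw [h4, h1 0 (by omega), hn]
      rintro _ rfl
      refine achieves_add ⟨fun i hi => ?_, ?_, ?_, ?_⟩
      · rw [Function.update_of_ne (by omega), Function.update_of_ne (by omega), h1 i hi]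
      · rw [Function.update_self, Function.update_of_ne (by omega),
          Function.update_of_ne (by omega), h2, h3]
      · rw [Function.update_of_ne (by omega), Function.update_of_ne (by omega), h3]
      · rw [Function.update_of_ne (by omega), Function.update_self]
        ring
    rintro ρ₂ ⟨h1, h2, h3, h4⟩
    refine (achieves_add (post := (· = Function.update ρ₂ d (x * n + y))) ?_).seq ?_
    · rw [h4, h1 b hb, hy]
    rintro _ rfl
    refine (achieves_load (post := (· = Function.update ρ₂ d (if G.Adj x y then 1 else 0)))
      ?_).seq ?_
    · rw [Function.update_self, Function.update_idem, hm]
    rintro _ rfl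
    cases c with
    | false =>
      refine achieves_skip ⟨fun i hi => ?_, ?_⟩
      · rw [Function.update_of_ne (by omega), h1 i hi]
      · rw [Function.update_self]
        by_cases hadj : G.Adj x y <;> simp [hadj, hxy]
    | true =>
      refine achieves_sub ⟨fun i hi => ?_, ?_⟩
      · rw [Function.update_of_ne (by omega), Function.update_of_ne (by omega), h1 i hi]
      · rw [Function.update_self, Function.update_self, Function.update_of_ne (by omega), h3]
        by_cases hadj : G.Adj x y <;> simp [hadj, hxy]
  have hne : ∀ {u v : ℕ}, ρ u < ρ v → (u = a ∧ v = b ∨ u = b ∧ v = a) → x ≠ y := by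
    rintro u v h huv rfl
    rcases huv with ⟨rfl, rfl⟩ | ⟨rfl, rfl⟩ <;>
    · rw [hρ _ ha, hρ _ hb, hx, hy] at h
      exact lt_irrefl _ h
  refine Achieves.mono (T := 3 * n + 7 + 1 + 1) ?_ (by omega) fun _ h => h
  refine achieves_branch (fun h => (hread (hne h (by simp))).mono (by omega) fun _ h => h)
    fun h => achieves_branch (fun h => hread (hne h (by simp))) fun h' => ?_
  refine Achieves.mono (achieves_const ⟨fun i hi => ?_, ?_⟩) (by omega) fun _ h => h
  · rw [Function.update_of_ne (by omega), hρ i hi]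
  · rw [hρ a ha, hρ b hb, hx, hy] at h h'
    have : x = y := Fin.ext (by omega)
    simp [this]

theorem computes_nbhdProg (hn : ρ₀ 0 = n)
    (hm : ∀ x y : Fin n, m (x * n + y) = open Classical in if G.Adj x y then 1 else 0)
    {L : List ℕ} {S : List (Fin n)} (hL : ∀ l ∈ L, l < d) (hS : L.map ρ₀ = S.map Fin.val) {a : ℕ}
    (ha : a < d) {y : Fin n} (hy : ρ₀ a = y) :
    Computes m (nbhdProg c L a d) d ρ₀ (0 < · ↔ y ∈ commonNbhd (bif c then Gᶜ else G) S)
      (16 * n * (L.length + 1)) := by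
  classical
  have hn1 : 1 ≤ n := by have := y.2; omega
  induction L generalizing S with
  | nil =>
    obtain rfl : S = [] := by simpa using hS.symm
    refine (computes_const 1).mono (by simp; omega) ?_
    rintro _ rfl
    simp [commonNbhd]
  | cons l L ih =>
    cases S with
    | nil => simp at hS
    | cons s S =>
      simp only [List.map_cons, List.cons.injEq] at hS
      refine Computes.mono ((computes_edgeProg hn hm (hL l (by simp)) ha hS.1 hy).and
        fun _ => ih (fun l hl => hL l (by simp [hl])) hS.2) ?_ fun z hz => ?_
      · simp only [List.length_cons]
        nlinarith
      · rw [hz]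
        simp [commonNbhd]

/-- The values of the registers `L` after writing into registers that do not occur in `L`. -/
theorem map_update_update {L : List ℕ} (hL : ∀ l ∈ L, l < d) (u v : ℕ) :
    L.map (Function.update (Function.update ρ₀ d u) (d + 1) v) = L.map ρ₀ := by
  refine List.map_congr_left fun l hl => ?_
  have := hL l hl
  rw [Function.update_of_ne (by omega), Function.update_of_ne (by omega)]

theorem update_update_of_lt {i : ℕ} (hi : i < d) (u v : ℕ) :
    Function.update (Function.update ρ₀ d u) (d + 1) v i = ρ₀ i := by
  rw [Function.update_of_ne (by omega), Function.update_of_ne (by omega)]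

theorem computes_coreProg (hn : ρ₀ 0 = n) (hk : ρ₀ 1 = k) (hd : 1 < d)
    (hm : ∀ x y : Fin n, m (x * n + y) = open Classical in if G.Adj x y then 1 else 0)
    {L : List ℕ} {S : List (Fin n)} (hL : ∀ l ∈ L, l < d) (hS : L.map ρ₀ = S.map Fin.val) {a : ℕ}
    (ha : a < d) {x : Fin n} (hx : ρ₀ a = x) :
    Computes m (coreProg c M L a d) d ρ₀ (0 < · ↔ x ∈ core (bif c then Gᶜ else G) M k S)
      (70 * n ^ 2 * (L.length + 1)) := by
  classical
  have hn1 : 1 ≤ n := by have := x.2; omega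
  have hsum := Computes.sum (m := m) (d := d) (n := n) (ρ₀ := ρ₀)
    (φ := fun y => y ∈ missing (bif c then Gᶜ else G) (commonNbhd (bif c then Gᶜ else G) S) x)
    M (by omega) hn fun acc y => Computes.mono
    ((computes_nbhdProg (c := c) (L := L) (S := S) (d := d + 2)
      ((update_update_of_lt (by omega) _ _).trans hn) hm
      (fun l hl => by have := hL l hl; omega) ((map_update_update hL _ _).trans hS) (a := d + 1)
      (by omega) (y := y) (by simp)).and fun _ =>
    (computes_edgeProg (c := c) ((update_update_of_lt (by omega) _ _).trans hn) hm (a := a)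
      (b := d + 1) (by omega) (by omega) (x := x) ((update_update_of_lt ha _ _).trans hx)
      (y := y) (by simp)).not) le_rfl fun z hz => by rw [hz, mem_missing]
  refine Computes.mono ((computes_nbhdProg hn hm hL hS ha hx).and fun _ => hsum.le hd) ?_
    fun z hz => ?_
  · have h1 : n ≤ n ^ 2 := by nlinarith
    have h2 : n ≤ n ^ 2 * (L.length + 1) := by nlinarith
    have h3 : n * (L.length + 1) ≤ n ^ 2 * (L.length + 1) := Nat.mul_le_mul_right _ h1
    nlinarith
  · rw [hz, hk, mem_core]
    simp

theorem computes_listProg (hn : ρ₀ 0 = n) (hk : ρ₀ 1 = k) (hd : 2 < d)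
    (hm : ∀ x y : Fin n, m (x * n + y) = open Classical in if G.Adj x y then 1 else 0)
    {L : List ℕ} {S : List (Fin n)} (hL : ∀ l ∈ L, l < d) (hS : L.map ρ₀ = S.map Fin.val)
    {v : Fin n} (hv : ρ₀ 2 = v) :
    Computes m (listProg c M L d) d ρ₀
      (0 < · ↔ v ∈ core (bif c then Gᶜ else G) M k S ∧
        k ≤ (core (bif c then Gᶜ else G) M k S).card)
      (160 * n ^ 3 * (L.length + 1)) := by
  classical
  have hn1 : 1 ≤ n := by have := v.2; omega
  have hsum := Computes.sum (m := m) (d := d) (n := n) (ρ₀ := ρ₀)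
    (φ := fun y => y ∈ core (bif c then Gᶜ else G) M k S) 1 (by omega) hn fun acc y =>
    (computes_coreProg (c := c) (L := L) (S := S) (M := M) (d := d + 2)
      ((update_update_of_lt (by omega) _ _).trans hn)
      ((update_update_of_lt (by omega) _ _).trans hk) (by omega) hm
      (fun l hl => by have := hL l hl; omega) ((map_update_update hL _ _).trans hS) (a := d + 1)
      (by omega) (x := y) (by simp))
  refine Computes.mono ((computes_coreProg hn hk (by omega) hm hL hS hd hv).and
    fun _ => hsum.ge (by omega)) ?_ fun z hz => ?_
  · have h1 : n ^ 2 ≤ n ^ 3 := Nat.pow_le_pow_right hn1 (by omega)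
    have h2 : n ≤ n ^ 3 * (L.length + 1) := by
      calc n = n ^ 1 * 1 := by ring
        _ ≤ n ^ 3 * (L.length + 1) :=
          Nat.mul_le_mul (Nat.pow_le_pow_right hn1 (by omega)) (by omega)
    have h3 : n ^ 2 * (L.length + 1) ≤ n ^ 3 * (L.length + 1) := Nat.mul_le_mul_right _ h1
    have h4 : n * (70 * n ^ 2 * (L.length + 1)) = 70 * (n ^ 3 * (L.length + 1)) := by ring
    nlinarith
  · rw [hz, hk]
    simp

theorem computes_searchProg (hn : ρ₀ 0 = n) (hk : ρ₀ 1 = k) (hd : 2 < d)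
    (hm : ∀ x y : Fin n, m (x * n + y) = open Classical in if G.Adj x y then 1 else 0)
    {L : List ℕ} {S : List (Fin n)} (hL : ∀ l ∈ L, l < d) (hS : L.map ρ₀ = S.map Fin.val)
    {v : Fin n} (hv : ρ₀ 2 = v) (r : ℕ) :
    Computes m (searchProg c M r L d) d ρ₀
      (0 < · ↔ ∃ S' : List (Fin n), S'.length = r ∧
        v ∈ core (bif c then Gᶜ else G) M k (S' ++ S) ∧
        k ≤ (core (bif c then Gᶜ else G) M k (S' ++ S)).card)
      ((160 * (L.length + r + 1) + 11 * r) * n ^ (r + 3)) := by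
  classical
  have hn1 : 1 ≤ n := by have := v.2; omega
  induction r generalizing L S d ρ₀ with
  | zero =>
    refine (computes_listProg hn hk hd hm hL hS hv).mono (le_of_eq (by ring)) fun z hz => ?_
    rw [hz]
    simp
  | succ r ih =>
    have hsum := Computes.sum (m := m) (d := d) (n := n) (ρ₀ := ρ₀) 1 (by omega) hn
      fun acc y => ih (d := d + 2)
        (ρ₀ := Function.update (Function.update ρ₀ d acc) (d + 1) (y : ℕ))
        (L := (d + 1) :: L) (S := y :: S)
        ((update_update_of_lt (by omega) _ _).trans hn)
        ((update_update_of_lt (by omega) _ _).trans hk) (by omega)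
        (by
          intro l hl
          rcases List.mem_cons.1 hl with rfl | hl
          · omega
          · have := hL l hl
            omega)
        (by rw [List.map_cons, List.map_cons, map_update_update hL, hS, Function.update_self])
        ((update_update_of_lt hd _ _).trans hv)
    refine hsum.mono ?_ fun z hz => ?_
    · have h1 : 1 ≤ n ^ (r + 3) := Nat.one_le_pow _ _ hn1
      have h2 : n * n ^ (r + 3) = n ^ (r + 1 + 3) := by ring
      have h3 : n ≤ n ^ (r + 1 + 3) := Nat.le_self_pow (by omega) n
      simp only [List.length_cons]
      calc _ = (160 * (L.length + 1 + r + 1) + 11 * r) * (n * n ^ (r + 3)) + 8 * n + 3 := by ring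
        _ ≤ (160 * (L.length + 1 + r + 1) + 11 * r) * n ^ (r + 1 + 3)
            + 8 * n ^ (r + 1 + 3) + 3 * n ^ (r + 1 + 3) := by
          rw [h2]
          omega
        _ = _ := by ring
    · subst hz
      rw [one_mul, Finset.card_pos, Finset.filter_nonempty_iff]
      constructor
      · rintro ⟨y, -, S', hlen, h⟩
        exact ⟨S' ++ [y], by simp [hlen], by simpa using h⟩
      · rintro ⟨S', hlen, h⟩
        obtain ⟨S'', y, rfl⟩ : ∃ S'' y, S' = S'' ++ [y] := by
          have hne : S' ≠ [] := by
            rintro rfl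
            simp at hlen
          exact ⟨S'.dropLast, S'.getLast hne, (List.dropLast_append_getLast hne).symm⟩
        exact ⟨y, Finset.mem_univ _, S'', by simpa using hlen, by simpa using h⟩

end Search

end RAM

/-! ### The algorithm -/

namespace RAM

/-- The vertex `v` passes the test: it belongs to a core with at least `k` vertices of some list
of `4 * M` vertices. -/
def Passes {n : ℕ} (G : SimpleGraph (Fin n)) (M k : ℕ) (v : Fin n) : Prop :=
  ∃ S : List (Fin n), S.length = 4 * M ∧ v ∈ core G M k S ∧ k ≤ (core G M k S).card

/-- Test the vertex in register `2`. If it fails, write `code` into register `3` and the vertex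
into register `4`. -/
def recordProg (c : Bool) (M code : ℕ) : Program :=
  .seq (searchProg c M (4 * M) [] 5) (.seq (.const 6 0)
    (.branch 6 5 .skip (.seq (.const 3 code) (.add 4 2 6))))

/-- Test all vertices in the graph and in its complement, and output the last failure. -/
def mainProg (M : ℕ) : Program :=
  .seq (.loop 2 0 (.seq (recordProg false M 1) (.seq (recordProg true M 2)
    (.seq (.const 6 1) (.add 2 2 6)))))
    (.seq (.const 6 0) (.seq (.add 0 3 6) (.add 1 4 6)))

/-- A bound for the factor in the running time of the test. -/
def timeFactor (M : ℕ) : ℕ := 160 * (4 * M + 1) + 11 * (4 * M)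

section

variable {n k : ℕ} {G : SimpleGraph (Fin n)} {m ρ : ℕ → ℕ}

theorem achieves_recordProg (c : Bool) (M code : ℕ) (hn : ρ 0 = n) (hk : ρ 1 = k)
    (hm : ∀ x y : Fin n, m (x * n + y) = open Classical in if G.Adj x y then 1 else 0)
    {v : Fin n} (hv : ρ 2 = v) :
    Achieves m (recordProg c M code) ρ (timeFactor M * n ^ (4 * M + 3) + 4) fun ρ' =>
      (∀ i < 3, ρ' i = ρ i) ∧
      (Passes (bif c then Gᶜ else G) M k v ∧ ρ' 3 = ρ 3 ∧ ρ' 4 = ρ 4 ∨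
        ¬ Passes (bif c then Gᶜ else G) M k v ∧ ρ' 3 = code ∧ ρ' 4 = v) := by
  have hsearch := computes_searchProg (c := c) (d := 5) (M := M) hn hk (by omega) hm (L := [])
    (S := []) (by simp) rfl hv (4 * M)
  refine Achieves.seq (T' := 1 + (2 + 1)) ((hsearch ρ fun _ _ => rfl).mono
    (le_of_eq (by simp [timeFactor])) fun _ h => h) ?_
  rintro ρ₁ ⟨hlow, hpass⟩
  have hpass' : 0 < ρ₁ 5 ↔ Passes (bif c then Gᶜ else G) M k v := by simpa [Passes] using hpass
  refine (achieves_const (post := (· = Function.update ρ₁ 6 0)) rfl).seq ?_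
  rintro _ rfl
  refine achieves_branch (fun h => ?_) (fun h => ?_)
  · refine Achieves.mono (achieves_skip ⟨fun i hi => ?_, Or.inl ⟨?_, ?_, ?_⟩⟩) (by omega)
      fun _ h => h
    · rw [Function.update_of_ne (by omega), hlow i (by omega)]
    · exact hpass'.1 (by simpa using h)
    · rw [Function.update_of_ne (by omega), hlow 3 (by omega)]
    · rw [Function.update_of_ne (by omega), hlow 4 (by omega)]
  · refine (achieves_const (post := (· = Function.update (Function.update ρ₁ 6 0) 3 code))
      rfl).seq (T' := 1) ?_
    rintro _ rfl
    refine achieves_add ⟨fun i hi => ?_, Or.inr ⟨?_, ?_, ?_⟩⟩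
    · rw [Function.update_of_ne (by omega), Function.update_of_ne (by omega),
        Function.update_of_ne (by omega), hlow i (by omega)]
    · exact fun hp => h (by simpa using hpass'.2 hp)
    · simp
    · simp [hlow 2 (by omega), hv]

theorem mem_inputState (G : SimpleGraph (Fin n)) (k : ℕ) (x y : Fin n) :
    (inputState G k).mem (x * n + y) = open Classical in if G.Adj x y then 1 else 0 := by
  classical
  have h : (∃ i j : Fin n, (x : ℕ) * n + y = i * n + j ∧ G.Adj i j) ↔ G.Adj x y := by
    refine ⟨?_, fun h => ⟨x, y, rfl, h⟩⟩
    rintro ⟨i, j, hij, h⟩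
    have hn0 : 0 < n := by have := x.2; omega
    have hdiv : ∀ a b : Fin n, ((a : ℕ) * n + b) / n = a := fun a b => by
      rw [mul_comm, Nat.mul_add_div hn0, Nat.div_eq_of_lt b.2, add_zero]
    have hxi : x = i := Fin.ext (by rw [← hdiv x y, hij, hdiv])
    subst hxi
    have hyj : y = j := Fin.ext (by omega)
    rwa [hyj]
  simp only [inputState, h]

/-- The running time of `mainProg` and its output in terms of the tests. -/
theorem exists_runs_mainProg (hn1 : 1 ≤ n) (G : SimpleGraph (Fin n)) (k M : ℕ) :
    ∃ t s, Runs (mainProg M) (inputState G k) t s ∧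
      t ≤ (2 * timeFactor M + 15) * n ^ (4 * M + 4) ∧
      (s.reg 0 = 0 ∧ (∀ v, Passes G M k v ∧ Passes Gᶜ M k v) ∨
        s.reg 0 = 1 ∧ (∃ v : Fin n, s.reg 1 = v ∧ ¬ Passes G M k v) ∨
        s.reg 0 = 2 ∧ (∃ v : Fin n, s.reg 1 = v ∧ ¬ Passes Gᶜ M k v)) := by
  let inv (x : ℕ) (ρ : ℕ → ℕ) : Prop :=
    (ρ 0 = n ∧ ρ 1 = k ∧ ρ 2 = x) ∧
    (ρ 3 = 0 ∧ (∀ v : Fin n, (v : ℕ) < x → Passes G M k v ∧ Passes Gᶜ M k v) ∨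
      ρ 3 = 1 ∧ (∃ v : Fin n, ρ 4 = v ∧ ¬ Passes G M k v) ∨
      ρ 3 = 2 ∧ (∃ v : Fin n, ρ 4 = v ∧ ¬ Passes Gᶜ M k v))
  set T := timeFactor M * n ^ (4 * M + 3) + 4 with hT
  have hm := mem_inputState G k
  obtain ⟨t, ρ', ht, hr, hp⟩ : Achieves (inputState G k).mem (mainProg M) (inputState G k).reg
      ((n * (T + (T + (1 + 1)) + 1) + 1) + (1 + (1 + 1))) fun ρ =>
        (ρ 0 = 0 ∧ (∀ v, Passes G M k v ∧ Passes Gᶜ M k v) ∨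
        ρ 0 = 1 ∧ (∃ v : Fin n, ρ 1 = v ∧ ¬ Passes G M k v) ∨
        ρ 0 = 2 ∧ (∃ v : Fin n, ρ 1 = v ∧ ¬ Passes Gᶜ M k v)) := by
    refine Achieves.seq (post := inv n) (achieves_loop (n := n) (inv := inv)
      (fun x ρ h => ⟨h.1.2.2, h.1.1⟩) ?_ n 0 (by omega) ?_) ?_
    · rintro x ρ hx ⟨⟨h0, h1, h2⟩, hans⟩
      refine (achieves_recordProg (G := G) (v := ⟨x, hx⟩) false M 1 h0 h1 hm h2).seq ?_
      rintro ρ₁ ⟨hlow₁, hans₁⟩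
      refine (achieves_recordProg (G := G) (v := ⟨x, hx⟩) true M 2 ((hlow₁ 0 (by omega)).trans h0)
        ((hlow₁ 1 (by omega)).trans h1) hm ((hlow₁ 2 (by omega)).trans h2)).seq ?_
      rintro ρ₂ ⟨hlow₂, hans₂⟩
      refine (achieves_const (post := (· = Function.update ρ₂ 6 1)) rfl).seq ?_
      rintro _ rfl
      refine achieves_add ⟨⟨?_, ?_, ?_⟩, ?_⟩
      · simp [hlow₂, hlow₁, h0]
      · simp [hlow₂, hlow₁, h1]
      · simp [hlow₂, hlow₁, h2]
      · have hout : ∀ y i : ℕ, i ≠ 2 → i ≠ 6 →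
            Function.update (Function.update ρ₂ 6 1) 2 y i = ρ₂ i := fun y i h h' => by
          rw [Function.update_of_ne h, Function.update_of_ne h']
        rw [hout _ 3 (by omega) (by omega), hout _ 4 (by omega) (by omega)]
        simp only [cond_true, cond_false] at hans₁ hans₂
        rcases hans₂ with ⟨hp₂, e3, e4⟩ | ⟨hp₂, e3, e4⟩
        · rw [e3, e4]
          rcases hans₁ with ⟨hp₁, f3, f4⟩ | ⟨hp₁, f3, f4⟩
          · rw [f3, f4]
            refine hans.imp_left fun h => ⟨h.1, fun v hv => ?_⟩
            rcases Nat.lt_succ_iff_lt_or_eq.1 hv with hv | hv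
            · exact h.2 v hv
            · obtain rfl : v = ⟨x, hx⟩ := Fin.ext hv
              exact ⟨hp₁, hp₂⟩
          · exact Or.inr (Or.inl ⟨f3, _, f4, hp₁⟩)
        · exact Or.inr (Or.inr ⟨e3, _, e4, hp₂⟩)
    · exact ⟨⟨rfl, rfl, rfl⟩, Or.inl ⟨rfl, by simp⟩⟩
    · rintro ρ ⟨-, hans⟩
      refine (achieves_const (post := (· = Function.update ρ 6 0)) rfl).seq ?_
      rintro _ rfl
      refine (achieves_add (post := (· = Function.update (Function.update ρ 6 0) 0 (ρ 3)))
        (by simp)).seq ?_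
      rintro _ rfl
      refine achieves_add ?_
      simpa using hans
  refine ⟨t, _, hr, ht.trans ?_, hp⟩
  have h1 : n ≤ n ^ (4 * M + 4) := Nat.le_self_pow (by omega) n
  have h2 : n * n ^ (4 * M + 3) = n ^ (4 * M + 4) := by ring
  calc _ = 2 * timeFactor M * (n * n ^ (4 * M + 3)) + 11 * n + 4 := by rw [hT]; ring
    _ ≤ 2 * timeFactor M * n ^ (4 * M + 4) + 11 * n ^ (4 * M + 4) + 4 * n ^ (4 * M + 4) := by
      rw [h2]
      omega
    _ = _ := by ring

end

end RAM

theorem inIndepSet_iff_inClique_compl {V : Type*} {G : SimpleGraph V} {k : ℕ} {v : V} :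
    InIndepSet G k v ↔ InClique Gᶜ k v := by
  simp only [InIndepSet, InClique, SimpleGraph.isNClique_compl]

theorem InClique.passes {n M k : ℕ} {G : SimpleGraph (Fin n)} {v : Fin n} (h : InClique G k v)
    (hk : 1 ≤ k) (hn : n ≤ 4 * k) (hM : 1 ≤ M) : RAM.Passes G M k v := by
  obtain ⟨C, hv, hC⟩ := h
  obtain ⟨S, hS, hsub⟩ := exists_subset_core hC hk (by simpa using hn) hM
  exact ⟨S, hS, hsub hv, hC.card_eq.ge.trans (Finset.card_le_card hsub)⟩

theorem RAM.Passes.exists_isNearClique {n M k : ℕ} {G : SimpleGraph (Fin n)} {v : Fin n}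
    (h : RAM.Passes G M k v) : ∃ Q, v ∈ Q ∧ IsNearClique G M k Q := by
  obtain ⟨S, -, hv, hk⟩ := h
  exact ⟨_, hv, isNearClique_core hk⟩

theorem mainTheorem2 :
    ∃ C : ℝ, 0 < C ∧ ∀ δ : ℝ, 0 < δ → δ < 1 →
      ∃ (P : RAM.Program) (K : ℕ) (B : ℝ),
        ∀ (n k : ℕ) (G : SimpleGraph (Fin n)), 1 ≤ n → (n : ℝ) ≤ (4 - δ) * (k : ℝ) →
          (K < k → ∃ v : Fin n, IsExcluding G k v) ∧
          ∃ (t : ℕ) (s : RAM.State),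
            RAM.Runs P (inputState G k) t s ∧
            (t : ℝ) ≤ B * (n : ℝ) ^ (C / δ ^ 2) ∧
            (k ≤ K → (t : ℝ) ≤ B) ∧
            IsCorrectAnswer G k s := by
  -- The running time is `O (n ^ (4 * M + 4))` where `M = ⌈3072 / δ ^ 2⌉ ≤ 3073 / δ ^ 2`.
  refine ⟨12296, by norm_num, fun δ hδ hδ1 => ?_⟩
  have hδ2 : 0 < δ ^ 2 := by positivity
  obtain ⟨M, hM, hM'⟩ : ∃ M : ℕ, 3072 ≤ δ ^ 2 * M ∧ δ ^ 2 * M ≤ 3073 := by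
    refine ⟨⌈3072 / δ ^ 2⌉₊, ?_, ?_⟩
    · rw [mul_comm, ← div_le_iff₀ hδ2]
      exact Nat.le_ceil _
    · have h := (Nat.ceil_lt_add_one (show 0 ≤ 3072 / δ ^ 2 by positivity)).le
      calc δ ^ 2 * (⌈3072 / δ ^ 2⌉₊ : ℝ) ≤ δ ^ 2 * (3072 / δ ^ 2 + 1) := by gcongr
        _ = 3072 + δ ^ 2 := by field_simp
        _ ≤ 3073 := by nlinarith
  have hM1 : 1 ≤ M := by
    by_contra! h
    obtain rfl : M = 0 := by omega
    norm_num at hM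
  set c := 2 * RAM.timeFactor M + 15 with hc
  refine ⟨RAM.mainProg M, M - 1, c * (4 * M : ℝ) ^ (4 * M + 4), fun n k G hn hnk => ?_⟩
  have hn4 : n ≤ 4 * k := by
    have : (n : ℝ) ≤ 4 * k := by nlinarith [(Nat.cast_nonneg k : (0 : ℝ) ≤ k)]
    exact_mod_cast this
  have hk : 1 ≤ k := by omega
  have hn1 : (1 : ℝ) ≤ n := by exact_mod_cast hn
  have hM1' : (1 : ℝ) ≤ M := by exact_mod_cast hM1
  have : Nonempty (Fin n) := ⟨⟨0, hn⟩⟩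
  -- For large `k`, some vertex lies in no near-clique or in no near-independent set.
  have hlarge : M - 1 < k → ¬ ∀ v, RAM.Passes G M k v ∧ RAM.Passes Gᶜ M k v := by
    intro hMk h
    have := lt_card_of_forall_mem_isNearClique hδ hδ1 hM (by omega)
      (fun v => (h v).1.exists_isNearClique) (fun v => (h v).2.exists_isNearClique)
    rw [Fintype.card_fin] at this
    linarith
  refine ⟨fun hMk => ?_, ?_⟩
  · by_contra! h
    refine hlarge hMk fun v => ?_
    have hv := not_not.1 (h v)
    exact ⟨hv.1.passes hk hn4 hM1, (inIndepSet_iff_inClique_compl.1 hv.2).passes hk hn4 hM1⟩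
  obtain ⟨t, s, hrun, ht, hans⟩ := RAM.exists_runs_mainProg hn G k M
  have ht' : (t : ℝ) ≤ c * (n : ℝ) ^ (4 * M + 4) := by exact_mod_cast ht
  refine ⟨t, s, hrun, ht'.trans ?_, fun hkM => ht'.trans ?_, ?_⟩
  · have h1 : (1 : ℝ) ≤ (4 * M : ℝ) ^ (4 * M + 4) := one_le_pow₀ (by linarith)
    have h2 : (n : ℝ) ^ (4 * M + 4) ≤ (n : ℝ) ^ ((12296 : ℝ) / δ ^ 2) := by
      rw [← Real.rpow_natCast]
      refine Real.rpow_le_rpow_of_exponent_le hn1 ?_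
      rw [le_div_iff₀ hδ2]
      push_cast
      nlinarith
    gcongr
    exact le_mul_of_one_le_right (Nat.cast_nonneg c) h1
  · have h3 : (n : ℝ) ≤ 4 * M := by exact_mod_cast (by omega : n ≤ 4 * M)
    gcongr
  · rcases hans with ⟨h0, h⟩ | ⟨h1, v, hv, h⟩ | ⟨h2, v, hv, h⟩
    · refine Or.inl ⟨h0, fun v hv => hv ?_⟩
      have hkM : k < M := by
        by_contra hMk
        exact hlarge (by omega) h
      obtain ⟨Q, hvQ, hQ⟩ := (h v).1.exists_isNearClique
      obtain ⟨J, hvJ, hJ⟩ := (h v).2.exists_isNearClique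
      exact ⟨hQ.inClique hkM hk hvQ, inIndepSet_iff_inClique_compl.2 (hJ.inClique hkM hk hvJ)⟩
    · exact Or.inr (Or.inl ⟨h1, v, hv, fun hC => h (hC.passes hk hn4 hM1)⟩)
    · exact Or.inr (Or.inr ⟨h2, v, hv, fun hC =>
        h ((inIndepSet_iff_inClique_compl.1 hC).passes hk hn4 hM1)⟩)
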